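/- Let $n,d\ge 1$, let $1<p<\infty$, let $\Omega\subset\mathbb{R}^n$ be a bounded domain (non-empty, open and connected) with Lipschitz boundary, let $u_0\in W^{1,p}(\Omega,\mathbb{R}^d)$, and put $\mathcal{W}:=u_0+W^{1,p}_0(\Omega,\mathbb{R}^d)$, where $W^{1,p}_0(\Omega,\mathbb{R}^d)$ is the closure of $C_c^\infty(\Omega,\mathbb{R}^d)$ in $W^{1,p}(\Omega,\mathbb{R}^d)$. Let $f:\overline\Omega\times\mathbb{R}^d\times\mathbb{R}^{nd}\to\mathbb{R}$ be continuous and satisfy the $p$-growth condition: there are $q\in[1,p)$, $c_0>0$, $c_1\in\mathbb{R}$ and $c_2\in L^1(\Omega)$ such that $$f(x,u,\xi)\ \ge\ c_0|\xi|^p+c_1|u|^q+c_2(x)\qquad\text{for all }(x,u,\xi)\in\overline\Omega\times\mathbb{R}^d\times\mathbb{R}^{nd}.$$ Let $F(v):=\int_\Omega f(x,v(x),\nabla v(x))\,dx\in[-\infty,\infty]$ for $v\in\mathcal{W}$, and assume that $F(v)<\infty$ for some $v\in\mathcal{W}$ and that $F(v)>-\infty$ for all $v\in\mathcal{W}$.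 Let $(u_k)$ be a minimizing sequence of $F$ in $\mathcal{W}$, that is, $u_k\in\mathcal{W}$ for all $k$ and $F(u_k)\to\inf_{v\in\mathcal{W}}F(v)$. Then $(u_k)$ is bounded in $W^{1,p}(\Omega,\mathbb{R}^d)$. -/

import Mathlib

open MeasureTheory TopologicalSpace Filter
open scoped Topology NNReal ENNReal Distributions

namespace CalcVar

noncomputable section

/-- The Euclidean space `ℝⁿ`. -/
abbrev Eucl (n : ℕ) : Type := EuclideanSpace ℝ (Fin n)

/-- The space `ℝ^{nd}` of gradients of maps from `ℝⁿ` to `ℝᵈ`, with its Euclidean norm; the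
entry `(i, j)` stands for `∂u_i / ∂x_j`. -/
abbrev Grad (n d : ℕ) : Type := EuclideanSpace ℝ (Fin d × Fin n)

/-- Near each boundary point, `Ω` is the part lying strictly above the graph of a Lipschitz
function of the variables orthogonal to some unit vector `e` (the local vertical direction). -/
def HasLipschitzBoundary {n : ℕ} (Ω : Set (Eucl n)) : Prop :=
  ∀ x ∈ frontier Ω, ∃ U ∈ 𝓝 x, ∃ e : Eucl n, ‖e‖ = 1 ∧
    ∃ (K : ℝ≥0) (g : Eucl n → ℝ), LipschitzWith K g ∧
      ∀ y ∈ U, (y ∈ Ω ↔ g (y - inner ℝ e y • e) < inner ℝ e y)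

/-- `G` is a weak gradient of `u` on `Ω`. Functions on `Ω` are represented by functions on `ℝⁿ`,
whose values outside `Ω` are irrelevant. -/
structure HasWeakGradient {n d : ℕ} (Ω : Opens (Eucl n)) (u : Eucl n → Eucl d)
    (G : Eucl n → Grad n d) : Prop where
  locallyIntegrableOn : LocallyIntegrableOn u Ω
  locallyIntegrableOn_grad : LocallyIntegrableOn G Ω
  integral_eq : ∀ (φ : 𝓓(Ω, ℝ)) (i : Fin d) (j : Fin n),
    ∫ x in (Ω : Set (Eucl n)), u x i * fderiv ℝ φ x (EuclideanSpace.single j 1) =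
      -∫ x in (Ω : Set (Eucl n)), G x (i, j) * φ x

open Classical in
/-- The weak gradient `∇u` on `Ω` (unique up to null subsets of `Ω`), or `0` if there is none. -/
def weakGrad {n d : ℕ} (Ω : Opens (Eucl n)) (u : Eucl n → Eucl d) : Eucl n → Grad n d :=
  if h : ∃ G, HasWeakGradient Ω u G then h.choose else 0

/-- `u ∈ W^{1,p}(Ω, ℝᵈ)`. -/
structure MemW {n d : ℕ} (p : ℝ) (Ω : Opens (Eucl n)) (u : Eucl n → Eucl d) : Prop where
  memLp : MemLp u (ENNReal.ofReal p) (volume.restrict Ω)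
  exists_weakGradient : ∃ G, HasWeakGradient Ω u G
  memLp_weakGrad : MemLp (weakGrad Ω u) (ENNReal.ofReal p) (volume.restrict Ω)

/-- The norm `‖u‖_p + ‖∇u‖_p` of `W^{1,p}(Ω, ℝᵈ)`. -/
def wNorm {n d : ℕ} (p : ℝ) (Ω : Opens (Eucl n)) (u : Eucl n → Eucl d) : ℝ≥0∞ :=
  eLpNorm u (ENNReal.ofReal p) (volume.restrict Ω) +
    eLpNorm (weakGrad Ω u) (ENNReal.ofReal p) (volume.restrict Ω)

/-- `u ∈ W₀^{1,p}(Ω, ℝᵈ)`, the closure of `C_c^∞(Ω, ℝᵈ)` in `W^{1,p}(Ω, ℝᵈ)`. -/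
structure MemW₀ {n d : ℕ} (p : ℝ) (Ω : Opens (Eucl n)) (u : Eucl n → Eucl d) : Prop where
  memW : MemW p Ω u
  exists_approx : ∀ ε : ℝ≥0∞, 0 < ε → ∃ φ : 𝓓(Ω, Eucl d), wNorm p Ω (u - ⇑φ) < ε

/-- The affine space `u₀ + W₀^{1,p}(Ω, ℝᵈ)`. -/
def admissible {n d : ℕ} (p : ℝ) (Ω : Opens (Eucl n)) (u₀ : Eucl n → Eucl d) :
    Set (Eucl n → Eucl d) :=
  {u | ∃ w, MemW₀ p Ω w ∧ u = u₀ + w}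

/-- The integral of a real function with values in `[-∞, ∞]`: the integral of the positive part
minus that of the negative part. If both are infinite, the value is `⊥`. -/
def extIntegral {α : Type*} [MeasurableSpace α] (μ : Measure α) (g : α → ℝ) : EReal :=
  ((∫⁻ x, ENNReal.ofReal (g x) ∂μ : ℝ≥0∞) : EReal) -
    ((∫⁻ x, ENNReal.ofReal (-g x) ∂μ : ℝ≥0∞) : EReal)

/-- The functional `F(u) = ∫_Ω f(x, u, ∇u) dx`. -/
def energy {n d : ℕ} (Ω : Opens (Eucl n)) (f : Eucl n × Eucl d × Grad n d → ℝ)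
    (u : Eucl n → Eucl d) : EReal :=
  extIntegral (volume.restrict (Ω : Set (Eucl n))) fun x => f (x, u x, weakGrad Ω u x)

/-- The `p`-growth condition. -/
def PGrowth {n d : ℕ} (p : ℝ) (Ω : Opens (Eucl n)) (f : Eucl n × Eucl d × Grad n d → ℝ) : Prop :=
  ∃ q : ℝ, 1 ≤ q ∧ q < p ∧ ∃ c₀ : ℝ, 0 < c₀ ∧ ∃ (c₁ : ℝ) (c₂ : Eucl n → ℝ),
    IntegrableOn c₂ Ω ∧
    ∀ x ∈ closure (Ω : Set (Eucl n)), ∀ (u : Eucl d) (ξ : Grad n d),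
      c₀ * ‖ξ‖ ^ p + c₁ * ‖u‖ ^ q + c₂ x ≤ f (x, u, ξ)

/-- `u` is a minimizing sequence of `F` over `𝒲`. -/
def IsMinimizingSeq {X : Type*} (F : X → EReal) (𝒲 : Set X) (u : ℕ → X) : Prop :=
  (∀ k, u k ∈ 𝒲) ∧ Tendsto (fun k => F (u k)) atTop (𝓝 (sInf (F '' 𝒲)))

end

end CalcVar

/-! The theorem is coercivity of the energy on `u₀ + W₀^{1,p}`: on a sublevel set `F < M` the
gradient term of the growth condition dominates everything else.

Since `q < p`, Young-type absorption replaces `c₁|u|^q` by `-ε|u|^p` minus a constant, for any `ε >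
0`; the constant is integrable because `Ω` is bounded (`PGrowth.exists_absorbed`). The Poincaré
inequality, applied to `v - u₀`, gives `‖v‖_p ≤ A + R‖∇v‖_p` with `A`, `R` independent of `v`
(`exists_eLpNorm_le_of_mem_admissible`). For `ε` small compared with `c₀ / R^p`, the term `ε‖v‖_p^p`
costs at most half of `c₀‖∇v‖_p^p` plus a constant, so `F(v) < M` bounds `‖∇v‖_p`, and then `‖v‖_p`
by Poincaré once more.

The infimum is below `⊤`, so all but finitely many `u_k` lie in one sublevel set; each remaining
term has finite norm. -/

namespace CalcVar

/-! ### Weak gradients: linearity, uniqueness, and the smooth case -/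

section WeakGradient

variable {n d : ℕ} {Ω : Opens (Eucl n)}

theorem integrableOn_mul_of_tsupport_subset {f g : Eucl n → ℝ} (hf : LocallyIntegrableOn f Ω)
    (hg : Continuous g) (hgc : HasCompactSupport g) (hgs : tsupport g ⊆ Ω) :
    IntegrableOn (fun x => f x * g x) Ω := by
  have h1 : IntegrableOn (fun x => f x * g x) (tsupport g) :=
    (hf.integrableOn_compact_subset hgs hgc).mul_continuousOn hg.continuousOn hgc
  have h2 : Function.support (fun x => f x * g x) ⊆ tsupport g := fun x hx =>
    subset_tsupport g (right_ne_zero_of_mul hx)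
  exact ((integrableOn_iff_integrable_of_support_subset h2).1 h1).integrableOn

theorem LocallyIntegrableOn.eucl_apply {ι : Type*} [Fintype ι] {u : Eucl n → EuclideanSpace ℝ ι}
    (hu : LocallyIntegrableOn u Ω) (i : ι) : LocallyIntegrableOn (fun x => u x i) Ω :=
  (EuclideanSpace.proj (𝕜 := ℝ) i).locallyIntegrableOn_comp hu

theorem continuous_fderiv_apply {F : Type*} [NormedAddCommGroup F] [NormedSpace ℝ F]
    (φ : 𝓓(Ω, F)) (v : Eucl n) : Continuous fun x => fderiv ℝ φ x v :=
  (φ.contDiff.continuous_fderiv (by simp)).clm_apply continuous_const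

theorem tsupport_fderiv_apply_subset {F : Type*} [NormedAddCommGroup F] [NormedSpace ℝ F]
    (φ : 𝓓(Ω, F)) (v : Eucl n) : tsupport (fun x => fderiv ℝ φ x v) ⊆ tsupport φ :=
  (_root_.tsupport_fderiv_apply_subset ℝ v)

theorem hasCompactSupport_fderiv_apply {F : Type*} [NormedAddCommGroup F] [NormedSpace ℝ F]
    (φ : 𝓓(Ω, F)) (v : Eucl n) : HasCompactSupport (fun x => fderiv ℝ φ x v) :=
  φ.hasCompactSupport.fderiv_apply ℝ v

theorem HasWeakGradient.integrableOn_mul_fderiv {u : Eucl n → Eucl d} {G : Eucl n → Grad n d}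
    (h : HasWeakGradient Ω u G) (φ : 𝓓(Ω, ℝ)) (i : Fin d) (v : Eucl n) :
    IntegrableOn (fun x => u x i * fderiv ℝ φ x v) Ω :=
  integrableOn_mul_of_tsupport_subset (LocallyIntegrableOn.eucl_apply h.locallyIntegrableOn i)
    (continuous_fderiv_apply φ v) (hasCompactSupport_fderiv_apply φ v)
    ((tsupport_fderiv_apply_subset φ v).trans φ.tsupport_subset)

theorem HasWeakGradient.integrableOn_grad_mul {u : Eucl n → Eucl d} {G : Eucl n → Grad n d}
    (h : HasWeakGradient Ω u G) (φ : 𝓓(Ω, ℝ)) (ij : Fin d × Fin n) :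
    IntegrableOn (fun x => G x ij * φ x) Ω :=
  integrableOn_mul_of_tsupport_subset (LocallyIntegrableOn.eucl_apply h.locallyIntegrableOn_grad ij)
    φ.continuous φ.hasCompactSupport φ.tsupport_subset

theorem HasWeakGradient.add {u v : Eucl n → Eucl d} {G H : Eucl n → Grad n d}
    (hu : HasWeakGradient Ω u G) (hv : HasWeakGradient Ω v H) :
    HasWeakGradient Ω (u + v) (G + H) where
  locallyIntegrableOn := hu.locallyIntegrableOn.add hv.locallyIntegrableOn
  locallyIntegrableOn_grad := hu.locallyIntegrableOn_grad.add hv.locallyIntegrableOn_grad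
  integral_eq φ i j := by
    simp only [Pi.add_apply, PiLp.add_apply, add_mul]
    rw [integral_add (hu.integrableOn_mul_fderiv φ i _) (hv.integrableOn_mul_fderiv φ i _),
      integral_add (hu.integrableOn_grad_mul φ _) (hv.integrableOn_grad_mul φ _),
      hu.integral_eq, hv.integral_eq, neg_add]

theorem HasWeakGradient.sub {u v : Eucl n → Eucl d} {G H : Eucl n → Grad n d}
    (hu : HasWeakGradient Ω u G) (hv : HasWeakGradient Ω v H) :
    HasWeakGradient Ω (u - v) (G - H) where
  locallyIntegrableOn := hu.locallyIntegrableOn.sub hv.locallyIntegrableOn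
  locallyIntegrableOn_grad := hu.locallyIntegrableOn_grad.sub hv.locallyIntegrableOn_grad
  integral_eq φ i j := by
    simp only [Pi.sub_apply, PiLp.sub_apply, sub_mul]
    rw [integral_sub (hu.integrableOn_mul_fderiv φ i _) (hv.integrableOn_mul_fderiv φ i _),
      integral_sub (hu.integrableOn_grad_mul φ _) (hv.integrableOn_grad_mul φ _),
      hu.integral_eq, hv.integral_eq, neg_sub, neg_sub_neg]

/-- The fundamental lemma of the calculus of variations, entry by entry. As `weakGrad` is an
arbitrary choice, this is what makes it additive up to null sets. -/
theorem HasWeakGradient.ae_eq {u : Eucl n → Eucl d} {G H : Eucl n → Grad n d}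
    (hG : HasWeakGradient Ω u G) (hH : HasWeakGradient Ω u H) :
    G =ᵐ[volume.restrict (Ω : Set (Eucl n))] H := by
  have key : ∀ ij : Fin d × Fin n, ∀ᵐ x, x ∈ Ω → G x ij - H x ij = 0 := by
    intro ij
    refine Ω.isOpen.ae_eq_zero_of_integral_contDiff_smul_eq_zero
      ((LocallyIntegrableOn.eucl_apply hG.locallyIntegrableOn_grad ij).sub
        (LocallyIntegrableOn.eucl_apply hH.locallyIntegrableOn_grad ij)) fun g hg hgc hgs => ?_
    let φ : 𝓓(Ω, ℝ) := ⟨g, hg, hgc, hgs⟩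
    have e : ∫ x, g x • (G x ij - H x ij) = ∫ x in Ω, (G x ij * φ x - H x ij * φ x) := by
      rw [← setIntegral_eq_integral_of_forall_compl_eq_zero (s := (Ω : Set (Eucl n)))]
      · refine integral_congr_ae (Eventually.of_forall fun x => ?_)
        change g x * _ = _ * g x - _ * g x
        ring
      · intro x hx
        rw [image_eq_zero_of_notMem_tsupport (fun h => hx (hgs h)), zero_smul]
    have h1 := hG.integral_eq φ ij.1 ij.2
    have h2 := hH.integral_eq φ ij.1 ij.2
    rw [h1] at h2
    exact e.trans (by
      rw [integral_sub (hG.integrableOn_grad_mul φ _) (hH.integrableOn_grad_mul φ _),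
        neg_injective h2, sub_self])
  rw [EventuallyEq, ae_restrict_iff' Ω.isOpen.measurableSet]
  filter_upwards [ae_all_iff.2 key] with x hx hxΩ
  ext ij
  exact sub_eq_zero.1 (hx ij hxΩ)

theorem hasWeakGradient_weakGrad {u : Eucl n → Eucl d} (h : ∃ G, HasWeakGradient Ω u G) :
    HasWeakGradient Ω u (weakGrad Ω u) := by
  rw [weakGrad, dif_pos h]
  exact h.choose_spec

theorem HasWeakGradient.weakGrad_ae_eq {u : Eucl n → Eucl d} {G : Eucl n → Grad n d}
    (h : HasWeakGradient Ω u G) : weakGrad Ω u =ᵐ[volume.restrict (Ω : Set (Eucl n))] G :=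
  (hasWeakGradient_weakGrad ⟨G, h⟩).ae_eq h

theorem MemW.hasWeakGradient {p : ℝ} {u : Eucl n → Eucl d} (h : MemW p Ω u) :
    HasWeakGradient Ω u (weakGrad Ω u) :=
  hasWeakGradient_weakGrad h.exists_weakGradient

/-- The Jacobian matrix of `φ`, as a vector of the Euclidean space `ℝ^{nd}`. -/
noncomputable def classicalGrad (φ : Eucl n → Eucl d) (x : Eucl n) : Grad n d :=
  WithLp.toLp 2 fun ij => fderiv ℝ φ x (EuclideanSpace.single ij.2 1) ij.1

theorem continuous_classicalGrad (φ : 𝓓(Ω, Eucl d)) : Continuous (classicalGrad φ) := by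
  refine (PiLp.continuous_toLp 2 _).comp (continuous_pi fun ij => ?_)
  exact (EuclideanSpace.proj (𝕜 := ℝ) ij.1).continuous.comp (continuous_fderiv_apply φ _)

theorem hasWeakGradient_classicalGrad (φ : 𝓓(Ω, Eucl d)) :
    HasWeakGradient Ω φ (classicalGrad φ) where
  locallyIntegrableOn := φ.continuous.locallyIntegrable.locallyIntegrableOn _
  locallyIntegrableOn_grad := (continuous_classicalGrad φ).locallyIntegrable.locallyIntegrableOn _
  integral_eq ψ i j := by
    have hd : Differentiable ℝ φ := φ.contDiff.differentiable (by simp)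
    have hψ : Differentiable ℝ ψ := ψ.contDiff.differentiable (by simp)
    let L : Eucl d →L[ℝ] ℝ := EuclideanSpace.proj i
    have hφi : ∀ x, HasFDerivAt (fun x => φ x i) (L.comp (fderiv ℝ φ x)) x := fun x =>
      L.hasFDerivAt.comp x (hd x).hasFDerivAt
    have hfd : ∀ x v, fderiv ℝ (fun x => φ x i) x v = fderiv ℝ φ x v i := fun x v => by
      rw [(hφi x).fderiv]; rfl
    have hc : Continuous fun x => φ x i := L.continuous.comp φ.continuous
    have hc' : Continuous fun x => fderiv ℝ (fun x => φ x i) x (EuclideanSpace.single j 1) := by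
      simp only [hfd]
      exact L.continuous.comp (continuous_fderiv_apply φ _)
    have hψ0 : ∀ x ∉ (Ω : Set (Eucl n)), ψ x = 0 := fun x hx =>
      image_eq_zero_of_notMem_tsupport fun h => hx (ψ.tsupport_subset h)
    have hψ'0 : ∀ x ∉ (Ω : Set (Eucl n)), fderiv ℝ ψ x (EuclideanSpace.single j 1) = 0 :=
      fun x hx => image_eq_zero_of_notMem_tsupport
        (f := fun x => fderiv ℝ ψ x (EuclideanSpace.single j 1)) fun h =>
          hx (ψ.tsupport_subset (tsupport_fderiv_apply_subset ψ _ h))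
    -- Both integrands vanish off `Ω` because `ψ` is supported there, so integration by parts can be
    -- done on the whole space, without boundary terms.
    rw [setIntegral_eq_integral_of_forall_compl_eq_zero (fun x hx => by rw [hψ'0 x hx, mul_zero]),
      setIntegral_eq_integral_of_forall_compl_eq_zero (fun x hx => by rw [hψ0 x hx, mul_zero]),
      integral_mul_fderiv_eq_neg_fderiv_mul_of_integrable
        ((hc'.mul ψ.continuous).integrable_of_hasCompactSupport ψ.hasCompactSupport.mul_left)
        ((hc.mul (continuous_fderiv_apply ψ _)).integrable_of_hasCompactSupport
          (hasCompactSupport_fderiv_apply ψ _).mul_left)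
        ((hc.mul ψ.continuous).integrable_of_hasCompactSupport ψ.hasCompactSupport.mul_left)
        (fun x _ => (hφi x).differentiableAt) (fun x _ => hψ x)]
    simp only [hfd]
    rfl

end WeakGradient

/-! ### The Poincaré inequality -/

section Poincare

variable {n d : ℕ} {Ω : Opens (Eucl n)}

/-- Hölder's inequality against the constant function `1`. -/
theorem rpow_lintegral_le {α : Type*} [MeasurableSpace α] {μ : Measure α} {p : ℝ} (hp : 1 ≤ p)
    {g : α → ℝ≥0∞} (hg : AEMeasurable g μ) :
    (∫⁻ x, g x ∂μ) ^ p ≤ μ Set.univ ^ (p - 1) * ∫⁻ x, g x ^ p ∂μ := by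
  have hp0 : 0 < p := by linarith
  have h := eLpNorm'_le_eLpNorm'_mul_rpow_measure_univ (μ := μ) (f := g) one_pos hp
    hg.aestronglyMeasurable
  simp only [eLpNorm', enorm_eq_self, ENNReal.rpow_one, div_one] at h
  calc (∫⁻ x, g x ∂μ) ^ p
      ≤ ((∫⁻ x, g x ^ p ∂μ) ^ (1 / p) * μ Set.univ ^ (1 - 1 / p)) ^ p := by gcongr
    _ = μ Set.univ ^ (p - 1) * ∫⁻ x, g x ^ p ∂μ := by
      rw [ENNReal.mul_rpow_of_nonneg _ _ hp0.le, ← ENNReal.rpow_mul, ← ENNReal.rpow_mul,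
        one_div_mul_cancel hp0.ne', ENNReal.rpow_one, mul_comm, sub_mul,
        one_div_mul_cancel hp0.ne', one_mul]

/-- The fundamental theorem of calculus on the segment from `x` to `x + R • e`, at whose far end `φ`
vanishes. -/
theorem enorm_le_lintegral_line {F : Type*} [NormedAddCommGroup F] [NormedSpace ℝ F]
    [CompleteSpace F] (φ : 𝓓(Ω, F)) (e x : Eucl n) {R : ℝ} (hR : 0 ≤ R)
    (hx : φ (x + R • e) = 0) :
    ‖φ x‖ₑ ≤ ∫⁻ t in Set.Ioc 0 R, ‖fderiv ℝ φ (x + t • e) e‖ₑ := by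
  have hd : Differentiable ℝ φ := φ.contDiff.differentiable (by simp)
  have hline : ∀ t : ℝ, HasDerivAt (fun t : ℝ => x + t • e) e t := fun t => by
    simpa using ((hasDerivAt_id t).smul_const e).const_add x
  have hder : ∀ t : ℝ, HasDerivAt (fun t : ℝ => φ (x + t • e)) (fderiv ℝ φ (x + t • e) e) t :=
    fun t => (hd _).hasFDerivAt.comp_hasDerivAt t (hline t)
  have hc : Continuous fun t : ℝ => fderiv ℝ φ (x + t • e) e :=
    (continuous_fderiv_apply φ e).comp (by fun_prop)
  have h := intervalIntegral.integral_eq_sub_of_hasDerivAt (a := 0) (b := R)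
    (fun t _ => hder t) (hc.intervalIntegrable 0 R)
  rw [hx, zero_smul, add_zero, zero_sub, intervalIntegral.integral_of_le hR] at h
  rw [← enorm_neg, ← h]
  exact enorm_integral_le_lintegral_enorm _

/-- The directional Poincaré inequality: if translation by `R e` moves `Ω` off itself, then `R`
times the derivative in direction `e` controls a test function. -/
theorem lintegral_rpow_le_directional {F : Type*} [NormedAddCommGroup F] [NormedSpace ℝ F]
    [CompleteSpace F] {p : ℝ} (hp : 1 ≤ p) (φ : 𝓓(Ω, F)) (e : Eucl n) {R : ℝ} (hR : 0 < R)
    (hΩ : ∀ x ∈ Ω, x + R • e ∉ Ω) :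
    ∫⁻ x, ‖φ x‖ₑ ^ p ≤ ENNReal.ofReal R ^ p * ∫⁻ x, ‖fderiv ℝ φ x e‖ₑ ^ p := by
  have hp0 : 0 < p := by linarith
  have h0 : ∀ x, x ∉ Ω → φ x = 0 := fun x hx =>
    image_eq_zero_of_notMem_tsupport fun h => hx (φ.tsupport_subset h)
  have hc : Continuous fun z : Eucl n × ℝ => fderiv ℝ φ (z.1 + z.2 • e) e :=
    (continuous_fderiv_apply φ e).comp (by fun_prop)
  have hpt : ∀ x, ‖φ x‖ₑ ^ p ≤ ENNReal.ofReal R ^ (p - 1) *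
      ∫⁻ t in Set.Ioc 0 R, ‖fderiv ℝ φ (x + t • e) e‖ₑ ^ p := by
    intro x
    by_cases hx : x ∈ Ω
    · have hcx : Continuous fun t : ℝ => fderiv ℝ φ (x + t • e) e :=
        (continuous_fderiv_apply φ e).comp (by fun_prop)
      calc ‖φ x‖ₑ ^ p ≤ (∫⁻ t in Set.Ioc 0 R, ‖fderiv ℝ φ (x + t • e) e‖ₑ) ^ p := by
            gcongr
            exact enorm_le_lintegral_line φ e x hR.le (h0 _ (hΩ x hx))
        _ ≤ _ := by
            refine (rpow_lintegral_le hp hcx.enorm.measurable.aemeasurable).trans_eq ?_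
            simp
    · simp [h0 x hx, hp0]
  -- After Tonelli, translation invariance makes the inner integral over `x` independent of `t`;
  -- integrating over `t` then supplies the last factor `R`.
  calc ∫⁻ x, ‖φ x‖ₑ ^ p
      ≤ ∫⁻ x, ENNReal.ofReal R ^ (p - 1) *
          ∫⁻ t in Set.Ioc 0 R, ‖fderiv ℝ φ (x + t • e) e‖ₑ ^ p := lintegral_mono hpt
    _ = ENNReal.ofReal R ^ (p - 1) *
          ∫⁻ x, ∫⁻ t in Set.Ioc 0 R, ‖fderiv ℝ φ (x + t • e) e‖ₑ ^ p :=
        lintegral_const_mul' _ _ (ENNReal.rpow_ne_top_of_nonneg (by linarith) ENNReal.ofReal_ne_top)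
    _ = ENNReal.ofReal R ^ (p - 1) *
          ∫⁻ t in Set.Ioc 0 R, ∫⁻ x, ‖fderiv ℝ φ (x + t • e) e‖ₑ ^ p := by
        rw [lintegral_lintegral_swap (hc.enorm.measurable.pow_const p).aemeasurable]
    _ = ENNReal.ofReal R ^ (p - 1) *
          ∫⁻ _ in Set.Ioc 0 R, ∫⁻ x, ‖fderiv ℝ φ x e‖ₑ ^ p := by
        congr 2 with t
        exact lintegral_add_right_eq_self (fun x => ‖fderiv ℝ φ x e‖ₑ ^ p) (t • e)
    _ = ENNReal.ofReal R ^ p * ∫⁻ x, ‖fderiv ℝ φ x e‖ₑ ^ p := by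
        have hR0 : ENNReal.ofReal R ≠ 0 := by simpa using hR
        rw [lintegral_const, Measure.restrict_apply_univ, Real.volume_Ioc, sub_zero,
          mul_comm (∫⁻ x, _), ← mul_assoc]
        congr 1
        nth_rw 2 [← ENNReal.rpow_one (ENNReal.ofReal R)]
        rw [← ENNReal.rpow_add _ _ hR0 ENNReal.ofReal_ne_top, sub_add_cancel]

theorem norm_fderiv_single_le_norm_classicalGrad (φ : Eucl n → Eucl d) (x : Eucl n) (j : Fin n) :
    ‖fderiv ℝ φ x (EuclideanSpace.single j 1)‖ ≤ ‖classicalGrad φ x‖ := by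
  rw [EuclideanSpace.norm_eq, EuclideanSpace.norm_eq]
  gcongr
  rw [Fintype.sum_prod_type]
  refine Finset.sum_le_sum fun i _ => ?_
  exact Finset.single_le_sum
    (f := fun j : Fin n => ‖classicalGrad φ x (i, j)‖ ^ 2) (fun _ _ => by positivity)
    (Finset.mem_univ j)

/-- The Poincaré inequality for test functions. -/
theorem exists_eLpNorm_le_classicalGrad (hn : 1 ≤ n) (hΩ : Bornology.IsBounded (Ω : Set (Eucl n)))
    {p : ℝ} (hp : 1 ≤ p) :
    ∃ R : ℝ, 0 < R ∧ ∀ φ : 𝓓(Ω, Eucl d),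
      eLpNorm φ (ENNReal.ofReal p) (volume.restrict (Ω : Set (Eucl n))) ≤
        ENNReal.ofReal R * eLpNorm (classicalGrad φ) (ENNReal.ofReal p)
          (volume.restrict (Ω : Set (Eucl n))) := by
  obtain ⟨r, hr, hΩr⟩ := hΩ.subset_ball_lt 0 0
  have hp0 : 0 < p := by linarith
  refine ⟨2 * r, by positivity, fun φ => ?_⟩
  let j : Fin n := ⟨0, hn⟩
  let e : Eucl n := EuclideanSpace.single j 1
  have he : ‖e‖ = 1 := by simp [e]
  -- `Ω` lies in the open ball of radius `r`, so two of its points are never `2 * r` apart.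
  have hsep : ∀ x ∈ Ω, x + (2 * r) • e ∉ Ω := by
    intro x hx hx'
    have h1 := mem_ball_zero_iff.1 (hΩr hx)
    have h2 := mem_ball_zero_iff.1 (hΩr hx')
    have h3 : ‖(2 * r) • e‖ ≤ ‖x + (2 * r) • e‖ + ‖x‖ := by
      simpa using norm_sub_le (x + (2 * r) • e) x
    rw [norm_smul, he, mul_one, Real.norm_of_nonneg (by positivity)] at h3
    linarith
  have h := lintegral_rpow_le_directional hp φ e (by positivity) hsep
  have hzero : ∀ x, x ∉ (Ω : Set (Eucl n)) → fderiv ℝ φ x e = 0 := fun x hx =>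
    image_eq_zero_of_notMem_tsupport (f := fun x => fderiv ℝ φ x e) fun hx' =>
      hx (φ.tsupport_subset (tsupport_fderiv_apply_subset φ _ hx'))
  have hres : ∫⁻ x, ‖fderiv ℝ φ x e‖ₑ ^ p = ∫⁻ x in Ω, ‖fderiv ℝ φ x e‖ₑ ^ p := by
    refine (setLIntegral_eq_of_support_subset fun x hx => ?_).symm
    by_contra hxΩ
    exact hx (by simp [hzero x hxΩ, hp0])
  have hpE0 : ENNReal.ofReal p ≠ 0 := by simpa using hp0
  simp only [eLpNorm_eq_lintegral_rpow_enorm_toReal hpE0 ENNReal.ofReal_ne_top,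
    ENNReal.toReal_ofReal hp0.le]
  calc (∫⁻ x in Ω, ‖φ x‖ₑ ^ p) ^ (1 / p)
      ≤ (ENNReal.ofReal (2 * r) ^ p * ∫⁻ x in Ω, ‖classicalGrad φ x‖ₑ ^ p) ^ (1 / p) := by
        gcongr
        refine (setLIntegral_le_lintegral _ _).trans (h.trans ?_)
        rw [hres]
        gcongr with x
        rw [enorm_le_iff_norm_le]
        exact norm_fderiv_single_le_norm_classicalGrad φ x j
    _ = _ := by
        rw [ENNReal.mul_rpow_of_nonneg _ _ (by positivity), ← ENNReal.rpow_mul,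
          mul_one_div_cancel hp0.ne', ENNReal.rpow_one]

/-- The Poincaré inequality on `W₀^{1,p}`. -/
theorem exists_eLpNorm_le_weakGrad (hn : 1 ≤ n) (hΩ : Bornology.IsBounded (Ω : Set (Eucl n)))
    {p : ℝ} (hp : 1 ≤ p) :
    ∃ R : ℝ, 0 < R ∧ ∀ w : Eucl n → Eucl d, MemW₀ p Ω w →
      eLpNorm w (ENNReal.ofReal p) (volume.restrict (Ω : Set (Eucl n))) ≤
        ENNReal.ofReal R * eLpNorm (weakGrad Ω w) (ENNReal.ofReal p)
          (volume.restrict (Ω : Set (Eucl n))) := by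
  obtain ⟨R, hR, hφ⟩ := exists_eLpNorm_le_classicalGrad (d := d) hn hΩ hp
  refine ⟨R, hR, fun w hw => ?_⟩
  set μ := volume.restrict (Ω : Set (Eucl n))
  set q := ENNReal.ofReal p with hq
  have hq1 : 1 ≤ q := by rw [hq, ← ENNReal.ofReal_one]; exact ENNReal.ofReal_le_ofReal hp
  -- The error of approximating `w` by a test function enters twice: directly, and with factor `R`
  -- through the gradient in the inequality for `φ`.
  have step : ∀ ε : ℝ≥0∞, 0 < ε → eLpNorm w q μ ≤
      ENNReal.ofReal R * eLpNorm (weakGrad Ω w) q μ + (1 + ENNReal.ofReal R) * ε := by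
    intro ε hε
    obtain ⟨φ, hφε⟩ := hw.exists_approx ε hε
    have hg := (hw.memW.hasWeakGradient.sub (hasWeakGradient_classicalGrad φ)).weakGrad_ae_eq
    have h1 : eLpNorm (w - ⇑φ) q μ ≤ ε := le_self_add.trans hφε.le
    have h2 : eLpNorm (weakGrad Ω w - classicalGrad φ) q μ ≤ ε := by
      rw [← eLpNorm_congr_ae hg]
      exact le_add_self.trans hφε.le
    have hwm := hw.memW.memLp.aestronglyMeasurable
    have hGm := hw.memW.memLp_weakGrad.aestronglyMeasurable
    have hφm : AEStronglyMeasurable φ μ := φ.continuous.aestronglyMeasurable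
    have hφ'm : AEStronglyMeasurable (classicalGrad φ) μ :=
      (continuous_classicalGrad φ).aestronglyMeasurable
    calc eLpNorm w q μ = eLpNorm ((w - ⇑φ) + ⇑φ) q μ := by rw [sub_add_cancel]
      _ ≤ eLpNorm (w - ⇑φ) q μ + eLpNorm φ q μ := eLpNorm_add_le (hwm.sub hφm) hφm hq1
      _ ≤ ε + ENNReal.ofReal R * eLpNorm (classicalGrad φ) q μ := add_le_add h1 (hφ φ)
      _ = ε + ENNReal.ofReal R *
          eLpNorm (weakGrad Ω w - (weakGrad Ω w - classicalGrad φ)) q μ := by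
        rw [sub_sub_cancel]
      _ ≤ ε + ENNReal.ofReal R * (eLpNorm (weakGrad Ω w) q μ + ε) := by
        gcongr
        exact (eLpNorm_sub_le hGm (hGm.sub hφ'm) hq1).trans (by gcongr)
      _ = _ := by ring
  have hlim : Tendsto (fun ε : ℝ≥0∞ => ENNReal.ofReal R * eLpNorm (weakGrad Ω w) q μ +
      (1 + ENNReal.ofReal R) * ε) (𝓝[>] 0)
      (𝓝 (ENNReal.ofReal R * eLpNorm (weakGrad Ω w) q μ + (1 + ENNReal.ofReal R) * 0)) :=
    (tendsto_const_nhds.add (ENNReal.Tendsto.const_mul tendsto_id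
      (Or.inr (by simp)))).mono_left nhdsWithin_le_nhds
  rw [mul_zero, add_zero] at hlim
  exact ge_of_tendsto hlim (eventually_nhdsWithin_of_forall fun ε hε => step ε hε)

end Poincare

/-! ### Coercivity of the energy -/

section Coercivity

variable {n d : ℕ} {Ω : Opens (Eucl n)}

theorem MemW.add {p : ℝ} {u v : Eucl n → Eucl d} (hu : MemW p Ω u)
    (hv : MemW p Ω v) : MemW p Ω (u + v) where
  memLp := hu.memLp.add hv.memLp
  exists_weakGradient := ⟨_, hu.hasWeakGradient.add hv.hasWeakGradient⟩
  memLp_weakGrad := (memLp_congr_ae (hu.hasWeakGradient.add hv.hasWeakGradient).weakGrad_ae_eq).2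
    (hu.memLp_weakGrad.add hv.memLp_weakGrad)

theorem MemW.wNorm_lt_top {p : ℝ} {u : Eucl n → Eucl d} (hu : MemW p Ω u) : wNorm p Ω u < ⊤ :=
  ENNReal.add_lt_top.2 ⟨hu.memLp.eLpNorm_lt_top, hu.memLp_weakGrad.eLpNorm_lt_top⟩

/-- Lower order powers are absorbed by an arbitrarily small multiple of a higher one. -/
theorem exists_mul_rpow_le {p q c ε : ℝ} (hq : 0 ≤ q) (hqp : q < p) (hc : 0 ≤ c) (hε : 0 < ε) :
    ∃ C : ℝ, ∀ t : ℝ, 0 ≤ t → c * t ^ q ≤ ε * t ^ p + C := by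
  have hpq : 0 < p - q := sub_pos.2 hqp
  -- For `c > 0`, `T` is the crossover point where `c * t ^ q = ε * t ^ p`.
  set T : ℝ := (c / ε) ^ (p - q)⁻¹ with hT
  have hT0 : 0 ≤ T := by positivity
  refine ⟨c * T ^ q, fun t ht => ?_⟩
  rcases le_total t T with htT | hTt
  · have h1 : c * t ^ q ≤ c * T ^ q := by gcongr
    have h2 : 0 ≤ ε * t ^ p := by positivity
    linarith
  · have h1 : 0 ≤ c * T ^ q := by positivity
    rcases ht.eq_or_lt with rfl | ht0
    · have : T = 0 := le_antisymm hTt hT0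
      rw [this]
      have h2 : 0 ≤ ε * (0 : ℝ) ^ p := by positivity
      linarith
    · have h3 : c / ε ≤ t ^ (p - q) := by
        calc c / ε = T ^ (p - q) := by
              rw [hT, ← Real.rpow_mul (by positivity), inv_mul_cancel₀ hpq.ne', Real.rpow_one]
          _ ≤ t ^ (p - q) := by gcongr
      have h4 : c ≤ ε * t ^ (p - q) := by
        rw [mul_comm]; exact (div_le_iff₀ hε).1 h3
      have h5 : c * t ^ q ≤ ε * t ^ p := by
        calc c * t ^ q ≤ ε * t ^ (p - q) * t ^ q := by gcongr
          _ = ε * t ^ p := by rw [mul_assoc, ← Real.rpow_add ht0, sub_add_cancel]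
      linarith

/-- Positive and negative parts are compared separately. Both are finite for `h`, so no `∞ - ∞`
arises on that side, and `g` need not be measurable. -/
theorem integral_le_extIntegral {α : Type*} [MeasurableSpace α] {μ : Measure α} {g h : α → ℝ}
    (hh : Integrable h μ) (hle : h ≤ᵐ[μ] g) :
    ((∫ x, h x ∂μ : ℝ) : EReal) ≤ extIntegral μ g := by
  have h1 : ∫⁻ x, ENNReal.ofReal (h x) ∂μ ≤ ∫⁻ x, ENNReal.ofReal (g x) ∂μ :=
    lintegral_mono_ae (hle.mono fun x hx => ENNReal.ofReal_le_ofReal hx)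
  have h2 : ∫⁻ x, ENNReal.ofReal (-g x) ∂μ ≤ ∫⁻ x, ENNReal.ofReal (-h x) ∂μ :=
    lintegral_mono_ae (hle.mono fun x hx => ENNReal.ofReal_le_ofReal (neg_le_neg hx))
  have hp : ∫⁻ x, ENNReal.ofReal (h x) ∂μ ≠ ⊤ := hh.lintegral_lt_top.ne
  have hn : ∫⁻ x, ENNReal.ofReal (-h x) ∂μ ≠ ⊤ := hh.neg.lintegral_lt_top.ne
  calc ((∫ x, h x ∂μ : ℝ) : EReal)
      = ((∫⁻ x, ENNReal.ofReal (h x) ∂μ : ℝ≥0∞) : EReal) -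
        ((∫⁻ x, ENNReal.ofReal (-h x) ∂μ : ℝ≥0∞) : EReal) := by
        rw [integral_eq_lintegral_pos_part_sub_lintegral_neg_part hh, EReal.coe_sub,
          EReal.coe_ennreal_toReal hp, EReal.coe_ennreal_toReal hn]
    _ ≤ extIntegral μ g := EReal.sub_le_sub (by exact_mod_cast h1) (by exact_mod_cast h2)

theorem MemLp.integral_norm_rpow {α E : Type*} [MeasurableSpace α] {μ : Measure α}
    [NormedAddCommGroup E] {p : ℝ} (hp : 0 < p) {u : α → E} (hu : MemLp u (ENNReal.ofReal p) μ) :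
    Integrable (fun x => ‖u x‖ ^ p) μ ∧
      ∫ x, ‖u x‖ ^ p ∂μ = (eLpNorm u (ENNReal.ofReal p) μ).toReal ^ p := by
  have hp0 : ENNReal.ofReal p ≠ 0 := by simpa using hp
  have hi := hu.integrable_norm_rpow hp0 ENNReal.ofReal_ne_top
  rw [ENNReal.toReal_ofReal hp.le] at hi
  refine ⟨hi, ?_⟩
  have h0 : 0 ≤ ∫ x, ‖u x‖ ^ p ∂μ := integral_nonneg fun x => by positivity
  rw [hu.eLpNorm_eq_integral_rpow_norm hp0 ENNReal.ofReal_ne_top, ENNReal.toReal_ofReal hp.le,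
    ENNReal.toReal_ofReal (by positivity), ← Real.rpow_mul h0, inv_mul_cancel₀ hp.ne',
    Real.rpow_one]

theorem add_rpow_le_two_rpow_mul {p a b : ℝ} (hp : 0 ≤ p) (ha : 0 ≤ a) (hb : 0 ≤ b) :
    (a + b) ^ p ≤ 2 ^ p * (a ^ p + b ^ p) := by
  have ha' : 0 ≤ a ^ p := by positivity
  have hb' : 0 ≤ b ^ p := by positivity
  calc (a + b) ^ p ≤ (2 * max a b) ^ p := by
        gcongr
        linarith [le_max_left a b, le_max_right a b]
    _ = 2 ^ p * max a b ^ p := Real.mul_rpow (by norm_num) (le_max_of_le_left ha)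
    _ ≤ 2 ^ p * (a ^ p + b ^ p) := by
        gcongr
        rcases max_choice a b with h | h <;> rw [h] <;> linarith

theorem exists_eLpNorm_le_of_mem_admissible (hn : 1 ≤ n)
    (hΩ : Bornology.IsBounded (Ω : Set (Eucl n))) {p : ℝ} (hp : 1 ≤ p) {u₀ : Eucl n → Eucl d}
    (hu₀ : MemW p Ω u₀) :
    ∃ A R : ℝ, 0 ≤ A ∧ 0 < R ∧ ∀ v ∈ admissible p Ω u₀,
      (eLpNorm v (ENNReal.ofReal p) (volume.restrict (Ω : Set (Eucl n)))).toReal ≤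
        A + R * (eLpNorm (weakGrad Ω v) (ENNReal.ofReal p)
          (volume.restrict (Ω : Set (Eucl n)))).toReal := by
  obtain ⟨R, hR, hPoin⟩ := exists_eLpNorm_le_weakGrad (d := d) hn hΩ hp
  set μ := volume.restrict (Ω : Set (Eucl n))
  set q := ENNReal.ofReal p with hq
  have hq1 : 1 ≤ q := by rw [hq, ← ENNReal.ofReal_one]; exact ENNReal.ofReal_le_ofReal hp
  refine ⟨(eLpNorm u₀ q μ).toReal + R * (eLpNorm (weakGrad Ω u₀) q μ).toReal, R, by positivity, hR,
    ?_⟩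
  rintro v ⟨w, hw, rfl⟩
  have hadd := hu₀.hasWeakGradient.add hw.memW.hasWeakGradient
  have hv := hu₀.add hw.memW
  have hG : eLpNorm (weakGrad Ω w) q μ ≤
      eLpNorm (weakGrad Ω (u₀ + w)) q μ + eLpNorm (weakGrad Ω u₀) q μ := by
    have hae : weakGrad Ω w =ᵐ[μ] weakGrad Ω (u₀ + w) - weakGrad Ω u₀ := by
      filter_upwards [hadd.weakGrad_ae_eq] with x hx
      simp [hx]
    rw [eLpNorm_congr_ae hae]
    exact eLpNorm_sub_le hv.memLp_weakGrad.aestronglyMeasurable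
      hu₀.memLp_weakGrad.aestronglyMeasurable hq1
  have h : eLpNorm (u₀ + w) q μ ≤ eLpNorm u₀ q μ + ENNReal.ofReal R *
      (eLpNorm (weakGrad Ω (u₀ + w)) q μ + eLpNorm (weakGrad Ω u₀) q μ) := by
    refine (eLpNorm_add_le hu₀.memLp.aestronglyMeasurable hw.memW.memLp.aestronglyMeasurable
      hq1).trans ?_
    gcongr
    exact (hPoin w hw).trans (by gcongr)
  have ha := hu₀.memLp.eLpNorm_ne_top
  have hb := hu₀.memLp_weakGrad.eLpNorm_ne_top
  have hc := hv.memLp_weakGrad.eLpNorm_ne_top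
  have hbc := ENNReal.add_ne_top.2 ⟨hc, hb⟩
  have hRbc := ENNReal.mul_ne_top (ENNReal.ofReal_ne_top (r := R)) hbc
  have h' := ENNReal.toReal_mono (ENNReal.add_ne_top.2 ⟨ha, hRbc⟩) h
  rw [ENNReal.toReal_add ha hRbc, ENNReal.toReal_mul, ENNReal.toReal_add hc hb,
    ENNReal.toReal_ofReal hR.le] at h'
  linarith

/-- The constant `c₀` is fixed before `ε`, since `ε` will later be chosen in terms of `c₀` and the
Poincaré constant. -/
theorem PGrowth.exists_absorbed {p : ℝ} {f : Eucl n × Eucl d × Grad n d → ℝ}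
    (hΩ : Bornology.IsBounded (Ω : Set (Eucl n))) (hf : PGrowth p Ω f) :
    ∃ c₀ : ℝ, 0 < c₀ ∧ ∀ ε : ℝ, 0 < ε → ∃ c : Eucl n → ℝ, IntegrableOn c Ω ∧
      ∀ x ∈ Ω, ∀ (u : Eucl d) (ξ : Grad n d),
        c₀ * ‖ξ‖ ^ p - ε * ‖u‖ ^ p + c x ≤ f (x, u, ξ) := by
  obtain ⟨q, hq, hqp, c₀, hc₀, c₁, c₂, hc₂, hle⟩ := hf
  refine ⟨c₀, hc₀, fun ε hε => ?_⟩
  obtain ⟨C, hC⟩ := exists_mul_rpow_le (by linarith) hqp (abs_nonneg c₁) hε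
  refine ⟨fun x => c₂ x - C, hc₂.sub (integrableOn_const hΩ.measure_lt_top.ne), ?_⟩
  intro x hx u ξ
  have h1 := hle x (subset_closure hx) u ξ
  have h2 := hC ‖u‖ (norm_nonneg u)
  have h3 : -|c₁| * ‖u‖ ^ q ≤ c₁ * ‖u‖ ^ q := by
    gcongr
    exact neg_abs_le c₁
  linarith

/-- Sublevel sets of the energy in `u₀ + W₀^{1,p}` are bounded in `W^{1,p}`. -/
theorem exists_wNorm_le_of_energy_lt (hn : 1 ≤ n) (hΩ : Bornology.IsBounded (Ω : Set (Eucl n)))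
    {p : ℝ} (hp : 1 ≤ p) {u₀ : Eucl n → Eucl d} (hu₀ : MemW p Ω u₀)
    {f : Eucl n × Eucl d × Grad n d → ℝ} (hf : PGrowth p Ω f) (M : ℝ) :
    ∃ C : ℝ≥0, ∀ v ∈ admissible p Ω u₀, energy Ω f v < M → wNorm p Ω v ≤ C := by
  have hp0 : 0 < p := by linarith
  obtain ⟨A, R, hA, hR, hAR⟩ := exists_eLpNorm_le_of_mem_admissible hn hΩ hp hu₀
  obtain ⟨c₀, hc₀, hf⟩ := hf.exists_absorbed hΩ
  -- Chosen so that the gradient part of the bound on `ε * Y ^ p` in `hYp` is exactly `c₀ / 2 * X ^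
  -- p`.
  set ε : ℝ := c₀ / (2 * 2 ^ p * R ^ p) with hεdef
  have hε : 0 < ε := by positivity
  have hεR : ε * 2 ^ p * R ^ p = c₀ / 2 := by
    rw [hεdef]; field_simp
  obtain ⟨c, hc, hfc⟩ := hf ε hε
  -- `B` is what `hE` and `hYp` give on solving for `X ^ p`; the maximum with `0` keeps the base of
  -- the root nonnegative.
  set B : ℝ := 2 / c₀ * (M - (∫ x in Ω, c x) + ε * 2 ^ p * A ^ p) with hB
  set D : ℝ := max B 0 ^ p⁻¹ with hD
  refine ⟨Real.toNNReal (A + (R + 1) * D), ?_⟩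
  intro v hv hvM
  have hvW : MemW p Ω v := by
    obtain ⟨w, hw, rfl⟩ := hv
    exact hu₀.add hw.memW
  obtain ⟨hYi, hY⟩ := MemLp.integral_norm_rpow hp0 hvW.memLp
  obtain ⟨hXi, hX⟩ := MemLp.integral_norm_rpow hp0 hvW.memLp_weakGrad
  have hYX := hAR v hv
  have hw : wNorm p Ω v = ENNReal.ofReal
      ((eLpNorm v (ENNReal.ofReal p) (volume.restrict (Ω : Set (Eucl n)))).toReal +
        (eLpNorm (weakGrad Ω v) (ENNReal.ofReal p)
          (volume.restrict (Ω : Set (Eucl n)))).toReal) := by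
    rw [ENNReal.ofReal_add ENNReal.toReal_nonneg ENNReal.toReal_nonneg,
      ENNReal.ofReal_toReal hvW.memLp.eLpNorm_ne_top,
      ENNReal.ofReal_toReal hvW.memLp_weakGrad.eLpNorm_ne_top, wNorm]
  set X := (eLpNorm (weakGrad Ω v) (ENNReal.ofReal p)
    (volume.restrict (Ω : Set (Eucl n)))).toReal
  set Y := (eLpNorm v (ENNReal.ofReal p) (volume.restrict (Ω : Set (Eucl n)))).toReal
  have hX0 : 0 ≤ X := ENNReal.toReal_nonneg
  have hY0 : 0 ≤ Y := ENNReal.toReal_nonneg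
  have hi : Integrable (fun x => c₀ * ‖weakGrad Ω v x‖ ^ p - ε * ‖v x‖ ^ p)
      (volume.restrict (Ω : Set (Eucl n))) := (hXi.const_mul c₀).sub (hYi.const_mul ε)
  have hint : Integrable (fun x => c₀ * ‖weakGrad Ω v x‖ ^ p - ε * ‖v x‖ ^ p + c x)
      (volume.restrict (Ω : Set (Eucl n))) :=
    hi.add hc
  have hE : c₀ * X ^ p - ε * Y ^ p + ∫ x in Ω, c x < M := by
    have h := integral_le_extIntegral hint
      (g := fun x => f (x, v x, weakGrad Ω v x)) (by
        filter_upwards [ae_restrict_mem Ω.isOpen.measurableSet] with x hx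
        exact hfc x hx _ _)
    have h' := EReal.coe_lt_coe_iff.1 (h.trans_lt hvM)
    rwa [integral_add hi hc,
      integral_sub (hXi.const_mul c₀) (hYi.const_mul ε), integral_const_mul, integral_const_mul,
      hX, hY] at h'
  have hYp : ε * Y ^ p ≤ ε * 2 ^ p * A ^ p + c₀ / 2 * X ^ p := by
    calc ε * Y ^ p ≤ ε * (A + R * X) ^ p := by gcongr
      _ ≤ ε * (2 ^ p * (A ^ p + (R * X) ^ p)) := by
        gcongr
        exact add_rpow_le_two_rpow_mul hp0.le hA (by positivity)
      _ = ε * 2 ^ p * A ^ p + c₀ / 2 * X ^ p := by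
        rw [← hεR, Real.mul_rpow hR.le hX0]; ring
  have hXB : X ^ p ≤ B := by
    rw [hB, div_mul_eq_mul_div, le_div_iff₀ hc₀]
    linarith
  have hXD : X ≤ D := by
    calc X = (X ^ p) ^ p⁻¹ := by rw [← Real.rpow_mul hX0, mul_inv_cancel₀ hp0.ne', Real.rpow_one]
      _ ≤ D := by
        rw [hD]
        gcongr
        exact hXB.trans (le_max_left _ _)
  rw [hw]
  refine ENNReal.ofReal_le_ofReal ?_
  have : R * X ≤ R * D := by gcongr
  linarith

end Coercivity

end CalcVar

/-! ### Boundedness of minimizing sequences -/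

theorem theorem2 {n d : ℕ} (hn : 1 ≤ n) (p : ℝ) (hp : 1 < p)
    (Ω : TopologicalSpace.Opens (CalcVar.Eucl n))
    (hΩ : IsConnected (Ω : Set (CalcVar.Eucl n)))
    (hΩb : Bornology.IsBounded (Ω : Set (CalcVar.Eucl n)))
    (hΩL : CalcVar.HasLipschitzBoundary (Ω : Set (CalcVar.Eucl n)))
    (u₀ : CalcVar.Eucl n → CalcVar.Eucl d) (hu₀ : CalcVar.MemW p Ω u₀)
    (f : CalcVar.Eucl n × CalcVar.Eucl d × CalcVar.Grad n d → ℝ)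
    (hf : ContinuousOn f (closure (Ω : Set (CalcVar.Eucl n)) ×ˢ Set.univ))
    (hpG : CalcVar.PGrowth p Ω f)
    (hfin : (∃ u ∈ CalcVar.admissible p Ω u₀, CalcVar.energy Ω f u < ⊤) ∧
      ∀ u ∈ CalcVar.admissible p Ω u₀, ⊥ < CalcVar.energy Ω f u)
    (u : ℕ → CalcVar.Eucl n → CalcVar.Eucl d)
    (hu : CalcVar.IsMinimizingSeq (CalcVar.energy Ω f) (CalcVar.admissible p Ω u₀) u) :
    ∃ C : ℝ≥0, ∀ k, CalcVar.wNorm p Ω (u k) ≤ C := by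
  obtain ⟨v, hv, hvtop⟩ := hfin.1
  have hinf : sInf (CalcVar.energy Ω f '' CalcVar.admissible p Ω u₀) < ⊤ :=
    (sInf_le (Set.mem_image_of_mem _ hv)).trans_lt hvtop
  obtain ⟨M, hM, -⟩ := EReal.lt_iff_exists_real_btwn.1 hinf
  obtain ⟨C, hC⟩ := CalcVar.exists_wNorm_le_of_energy_lt hn hΩb hp.le hu₀ hpG M
  obtain ⟨N, hN⟩ := Filter.eventually_atTop.1 (hu.2.eventually_lt_const hM)
  have hW : ∀ k, CalcVar.wNorm p Ω (u k) ≠ ⊤ := fun k => by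
    obtain ⟨w, hw, hk⟩ := hu.1 k
    rw [hk]
    exact (hu₀.add hw.memW).wNorm_lt_top.ne
  -- `C` bounds the tail, and the sum dominates each of the first `N` norms.
  refine ⟨C + ∑ k ∈ Finset.range N, (CalcVar.wNorm p Ω (u k)).toNNReal, fun k => ?_⟩
  rcases lt_or_ge k N with hk | hk
  · rw [← ENNReal.coe_toNNReal (hW k), ENNReal.coe_le_coe]
    exact (Finset.single_le_sum (f := fun k => (CalcVar.wNorm p Ω (u k)).toNNReal)
      (fun _ _ => zero_le) (Finset.mem_range.2 hk)).trans le_add_self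
  · exact (hC _ (hu.1 k) (hN k hk)).trans (ENNReal.coe_le_coe.2 le_self_add)
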